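/- Call a function $f:\mathbb{Z}[i]\to\mathbb{Z}_{\ge 0}$ a Euclidean function if for all $a,b\in\mathbb{Z}[i]$ with $b\neq 0$ there are $q,r\in\mathbb{Z}[i]$ such that $a=qb+r$ and either $r=0$ or $f(r)<f(b)$ (the value $f(0)$ is otherwise unconstrained). Let $\phi_{\mathbb{Z}[i]}$ be the minimal Euclidean function on the Gaussian integers, i.e. $\phi_{\mathbb{Z}[i]}(x)=\min\{f(x): f \text{ a Euclidean function on } \mathbb{Z}[i]\}$ for every $x\in\mathbb{Z}[i]$; in particular $\phi_{\mathbb{Z}[i]}(0)=0$. Theorem. For every integer $k\ge 1$, the set $\phi_{\mathbb{Z}[i]}^{-1}([0,2k+1])$ of Gaussian integers at which $\phi_{\mathbb{Z}[i]}$ takes a value at most $2k+1$ is finite, and $$\left|\phi_{\mathbb{Z}[i]}^{-1}([0,2k+1])\right| = 29+8k-68\cdot 2^k+56\cdot 4^k .$$ -/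

import Mathlib

/-- `f : R → ℕ` is a Euclidean function on `R`: for every `a` and every nonzero `b` one can write
`a = q * b + r` with `r = 0` or `f r < f b`. The value `f 0` plays no role. -/
def IsEuclideanFunction {R : Type*} [CommRing R] (f : R → ℕ) : Prop :=
  ∀ a b : R, b ≠ 0 → ∃ q r : R, a = q * b + r ∧ (r = 0 ∨ f r < f b)

/-- The minimal Euclidean function of a Euclidean domain `R`: the pointwise minimum of all
Euclidean functions on `R`. As the value of a Euclidean function at `0` is unconstrained,
it takes the value `0` at `0`. -/
noncomputable def minimalEuclideanFunction (R : Type*) [CommRing R] (x : R) : ℕ :=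
  sInf {n : ℕ | ∃ f : R → ℕ, IsEuclideanFunction f ∧ f x = n}

/-! Let `A_0 = {0}`, and let `A_(n+1)` consist of `0` and of those `b` for which every residue class
modulo `b` meets `A_n`. The minimal Euclidean function is at most `n` exactly on `A_(n+1)`
(Motzkin). For the Gaussian integers, `A_n` is the set of the points `(1 + i) ^ s * y` with `s ≤ n`
and `y` an odd point of the `(n - s)`-th of a growing sequence of octagons (Lenstra).

If `b` belongs to `A_(n+1)`, the class of `(1 + i) ^ n` modulo `b` contains a point `r` of `A_n`.
As `(1 + i) ^ n` is not in `A_n`, the difference `(1 + i) ^ n - r` is a nonzero multiple of `b`, and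
it lies in the `(n + 1)`-st set of octagon points. These sets contain all divisors of their nonzero
elements: the octagons are so close to discs that splitting off an odd nonunit factor, which has
norm at least `3`, leaves a cofactor inside.

Conversely, let `b` be an odd point of the `(n + 1)`-st octagon, and let `r` have minimal norm in
its class modulo `b`. If `r` is not in the `n`-th set, it is even and close to the boundary of its
octagon, and subtracting an associate of `b` gives an odd point of that octagon. Even `b` follow by
induction.

The odd points of an octagon are those of a diamond with four corners cut off, which leads to a
recursion for the cardinality.
-/

section CommRing

variable {R : Type*} [CommRing R] {f : R → ℕ} {n : ℕ} {b x : R}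

variable (R) in
/-- Motzkin's construction: a nonzero `b` belongs to `motzkinSet R (n + 1)` when every residue class
modulo `b` has a representative in `motzkinSet R n`. The numbering starts at `{0}`, so the nonzero
points of `motzkinSet R n` are those where the minimal Euclidean function is less than `n`. -/
def motzkinSet : ℕ → Set R
  | 0 => {0}
  | n + 1 => {b | b = 0 ∨ ∀ a, ∃ r ∈ motzkinSet n, b ∣ a - r}

theorem zero_mem_motzkinSet (n : ℕ) : (0 : R) ∈ motzkinSet R n := by
  cases n with
  | zero => rfl
  | succ n => exact Or.inl rfl

theorem isEuclideanFunction_iff_exists_dvd_sub :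
    IsEuclideanFunction f ↔ ∀ a b : R, b ≠ 0 → ∃ r, b ∣ a - r ∧ (r = 0 ∨ f r < f b) := by
  refine forall₃_congr fun a b _ => ⟨?_, ?_⟩
  · rintro ⟨q, r, h, hr⟩
    exact ⟨r, ⟨q, by rw [h]; ring⟩, hr⟩
  · rintro ⟨r, ⟨q, hq⟩, hr⟩
    exact ⟨q, r, by linear_combination hq, hr⟩

theorem IsEuclideanFunction.mem_motzkinSet_succ (hf : IsEuclideanFunction f) (hb : f b ≤ n) :
    b ∈ motzkinSet R (n + 1) := by
  induction n generalizing b with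
  | zero =>
    refine or_iff_not_imp_left.2 fun hb0 a => ?_
    obtain ⟨r, hdvd, hr⟩ := isEuclideanFunction_iff_exists_dvd_sub.1 hf a b hb0
    exact ⟨r, hr.resolve_right (by omega), hdvd⟩
  | succ n ih =>
    refine or_iff_not_imp_left.2 fun hb0 a => ?_
    obtain ⟨r, hdvd, rfl | hr⟩ := isEuclideanFunction_iff_exists_dvd_sub.1 hf a b hb0
    · exact ⟨0, zero_mem_motzkinSet _, hdvd⟩
    · exact ⟨r, ih (by omega), hdvd⟩

theorem exists_isEuclideanFunction_le_of_mem_motzkinSet (hR : ∀ x, ∃ n, x ∈ motzkinSet R (n + 1)) :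
    ∃ g : R → ℕ, IsEuclideanFunction g ∧ ∀ n, ∀ x ∈ motzkinSet R (n + 1), g x ≤ n := by
  classical
  let g : R → ℕ := fun x => Nat.find (hR x)
  have g_le : ∀ n, ∀ x ∈ motzkinSet R (n + 1), g x ≤ n := fun n x hx => Nat.find_min' (hR x) hx
  refine ⟨g, isEuclideanFunction_iff_exists_dvd_sub.2 fun a b hb => ?_, g_le⟩
  have b_mem : b ∈ motzkinSet R (g b + 1) := Nat.find_spec (hR b)
  obtain ⟨r, hr, hdvd⟩ := b_mem.resolve_left hb a
  refine ⟨r, hdvd, ?_⟩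
  cases hgb : g b with
  | zero =>
    rw [hgb] at hr
    exact Or.inl hr
  | succ m =>
    rw [hgb] at hr
    exact Or.inr (Nat.lt_succ_of_le (g_le m r hr))

theorem minimalEuclideanFunction_le_iff_mem_motzkinSet (hf : IsEuclideanFunction f) :
    minimalEuclideanFunction R x ≤ n ↔ x ∈ motzkinSet R (n + 1) := by
  constructor
  · intro hx
    obtain ⟨g, hg, hgx⟩ : minimalEuclideanFunction R x ∈
        {n : ℕ | ∃ g : R → ℕ, IsEuclideanFunction g ∧ g x = n} := Nat.sInf_mem ⟨f x, f, hf, rfl⟩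
    exact hg.mem_motzkinSet_succ (hgx.trans_le hx)
  · intro hx
    obtain ⟨g, hg, g_le⟩ := exists_isEuclideanFunction_le_of_mem_motzkinSet
      fun y => ⟨f y, hf.mem_motzkinSet_succ le_rfl⟩
    have min_le : minimalEuclideanFunction R x ≤ g x := Nat.sInf_le ⟨g, hg, rfl⟩
    exact min_le.trans (g_le n x hx)

end CommRing

theorem isEuclideanFunction_natAbs_norm :
    IsEuclideanFunction fun z : GaussianInt => z.norm.natAbs := fun a b hb =>
  ⟨a / b, a % b, by rw [mul_comm, EuclideanDomain.div_add_mod],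
    Or.inr (GaussianInt.natAbs_norm_mod_lt a hb)⟩

theorem re_im_unit (u : GaussianIntˣ) :
    (u.val.re = 1 ∨ u.val.re = -1) ∧ u.val.im = 0 ∨
      u.val.re = 0 ∧ (u.val.im = 1 ∨ u.val.im = -1) := by
  have norm_eq_one : u.val.norm = 1 := (Zsqrtd.norm_eq_one_iff' (by norm_num) _).2 u.isUnit
  have sq_add_sq : u.val.re * u.val.re + u.val.im * u.val.im = 1 := by
    rw [Zsqrtd.norm_def] at norm_eq_one
    linarith
  clear norm_eq_one
  generalize u.val.re = s at *
  generalize u.val.im = t at *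
  obtain ⟨hs₁, hs₂⟩ : -1 ≤ s ∧ s ≤ 1 := ⟨by nlinarith, by nlinarith⟩
  obtain ⟨ht₁, ht₂⟩ : -1 ≤ t ∧ t ≤ 1 := ⟨by nlinarith, by nlinarith⟩
  interval_cases s <;> interval_cases t <;> omega

section Parity

variable {z : GaussianInt}

/-- The Gaussian prime `1 + i`; the Gaussian integers it does not divide are called odd. -/
def onePlusI : GaussianInt := ⟨1, 1⟩

theorem re_onePlusI_mul (z : GaussianInt) : (onePlusI * z).re = z.re - z.im := by
  simp [onePlusI, sub_eq_add_neg]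

theorem im_onePlusI_mul (z : GaussianInt) : (onePlusI * z).im = z.re + z.im := by
  simp [onePlusI, add_comm]

theorem onePlusI_dvd_iff : onePlusI ∣ z ↔ 2 ∣ z.re + z.im := by
  constructor
  · rintro ⟨y, rfl⟩
    exact ⟨y.re, by rw [re_onePlusI_mul, im_onePlusI_mul]; ring⟩
  · intro h
    refine ⟨⟨(z.re + z.im) / 2, (z.im - z.re) / 2⟩, Zsqrtd.ext ?_ ?_⟩
    · rw [re_onePlusI_mul]; dsimp only; omega
    · rw [im_onePlusI_mul]; dsimp only; omega

theorem onePlusI_dvd_star_iff : onePlusI ∣ star z ↔ onePlusI ∣ z := by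
  rw [onePlusI_dvd_iff, onePlusI_dvd_iff, Zsqrtd.re_star, Zsqrtd.im_star]
  omega

theorem prime_onePlusI : Prime onePlusI := by
  refine ⟨fun h => by simpa [onePlusI] using congrArg Zsqrtd.re h, fun h => ?_, fun a b h => ?_⟩
  · have := (Zsqrtd.norm_eq_one_iff' (by norm_num) onePlusI).2 h
    simp [onePlusI, Zsqrtd.norm_def] at this
  · rw [onePlusI_dvd_iff] at h
    have re_add_im_mul : (a * b).re + (a * b).im =
        (a.re + a.im) * (b.re + b.im) - 2 * (a.im * b.im) := by
      rw [Zsqrtd.re_mul, Zsqrtd.im_mul]; ring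
    rw [re_add_im_mul, dvd_sub_left (dvd_mul_right 2 _), Int.prime_two.dvd_mul] at h
    simpa only [onePlusI_dvd_iff] using h

theorem two_dvd_norm_iff : 2 ∣ z.norm ↔ onePlusI ∣ z := by
  have norm_eq : z.norm = (z.re + z.im) ^ 2 - 2 * (z.re * z.im) := by
    rw [Zsqrtd.norm_def]; ring
  rw [norm_eq, dvd_sub_left (dvd_mul_right 2 _), Int.prime_two.dvd_pow_iff_dvd two_ne_zero,
    onePlusI_dvd_iff]

theorem onePlusI_dvd_sub_one (h : ¬ onePlusI ∣ z) : onePlusI ∣ z - 1 := by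
  rw [onePlusI_dvd_iff] at h ⊢
  rw [Zsqrtd.re_sub, Zsqrtd.im_sub, Zsqrtd.re_one, Zsqrtd.im_one]
  omega

end Parity

section Octagon

variable {A A' B B' : ℤ} {z w : GaussianInt}

/-- The Gaussian integers in the octagon cut out by the square `max |x| |y| ≤ A` and the diamond
`|x| + |y| ≤ B`. -/
def octagon (A B : ℤ) : Set GaussianInt :=
  {z | |z.re| ≤ A ∧ |z.im| ≤ A ∧ |z.re| + |z.im| ≤ B}

theorem mem_octagon_iff : z ∈ octagon A B ↔
    z.re ≤ A ∧ -z.re ≤ A ∧ z.im ≤ A ∧ -z.im ≤ A ∧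
      z.re + z.im ≤ B ∧ z.re - z.im ≤ B ∧ -z.re + z.im ≤ B ∧ -z.re - z.im ≤ B := by
  change |z.re| ≤ A ∧ |z.im| ≤ A ∧ |z.re| + |z.im| ≤ B ↔ _
  rcases abs_cases z.re with ⟨hre, _⟩ | ⟨hre, _⟩ <;>
    rcases abs_cases z.im with ⟨him, _⟩ | ⟨him, _⟩ <;> omega

theorem octagon_mono (hA : A ≤ A') (hB : B ≤ B') : octagon A B ⊆ octagon A' B' :=
  fun _ hz => ⟨hz.1.trans hA, hz.2.1.trans hA, hz.2.2.trans hB⟩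

theorem octagon_finite (A B : ℤ) : (octagon A B).Finite := by
  let box : Set (ℤ × ℤ) := Set.Icc (-A) A ×ˢ Set.Icc (-A) A
  have box_finite : box.Finite := (Set.finite_Icc _ _).prod (Set.finite_Icc _ _)
  refine (box_finite.image fun p => (⟨p.1, p.2⟩ : GaussianInt)).subset fun z hz => ?_
  exact ⟨(z.re, z.im), ⟨abs_le.1 hz.1, abs_le.1 hz.2.1⟩, rfl⟩

theorem add_mem_octagon (hz : z ∈ octagon A B) (hw : w ∈ octagon A' B') :
    z + w ∈ octagon (A + A') (B + B') := by
  rw [mem_octagon_iff] at hz hw ⊢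
  rw [Zsqrtd.re_add, Zsqrtd.im_add]
  omega

theorem star_mem_octagon (hz : z ∈ octagon A B) : star z ∈ octagon A B := by
  simpa [octagon] using hz

theorem unit_mul_mem_octagon (u : GaussianIntˣ) (hz : z ∈ octagon A B) :
    ↑u * z ∈ octagon A B := by
  rw [mem_octagon_iff] at hz ⊢
  rw [Zsqrtd.re_mul, Zsqrtd.im_mul]
  rcases re_im_unit u with ⟨hre | hre, him⟩ | ⟨hre, him | him⟩ <;> rw [hre, him] <;> omega

theorem unit_mul_mem_octagon_iff (u : GaussianIntˣ) : ↑u * z ∈ octagon A B ↔ z ∈ octagon A B :=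
  ⟨fun h => by simpa using unit_mul_mem_octagon u⁻¹ h, unit_mul_mem_octagon u⟩

theorem onePlusI_mul_mem_octagon (hz : z ∈ octagon A B) : onePlusI * z ∈ octagon B (2 * A) := by
  rw [mem_octagon_iff] at hz ⊢
  rw [re_onePlusI_mul, im_onePlusI_mul]
  omega

theorem norm_le_of_mem_octagon (hz : z ∈ octagon A B) : z.norm ≤ 2 * A ^ 2 := by
  have re_sq : z.re ^ 2 ≤ A ^ 2 := sq_le_sq.2 (hz.1.trans (le_abs_self A))
  have im_sq : z.im ^ 2 ≤ A ^ 2 := sq_le_sq.2 (hz.2.1.trans (le_abs_self A))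
  rw [Zsqrtd.norm_def]
  linarith

end Octagon

section LenstraSet

variable {n : ℕ} {J : ℤ} {b d r z : GaussianInt}

/-- The sizes `2, 3, 4, 6, 8, 12, …` of Lenstra's octagons. His sequence starts at `3`; the extra
term in front makes the octagon of index `0` the single point `0`. -/
def octagonSize : ℕ → ℤ
  | 0 => 2
  | 1 => 3
  | n + 2 => 2 * octagonSize n

theorem octagonSize_add_two (n : ℕ) : octagonSize (n + 1 + 1) = 2 * octagonSize n := rfl

theorem octagonSize_cases (n : ℕ) : ∃ D : ℤ, 0 < D ∧
    (octagonSize n = 3 * D ∧ octagonSize (n + 1) = 4 * D ∨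
      octagonSize n = 2 * D ∧ octagonSize (n + 1) = 3 * D ∧ (D = 1 ∨ 2 ∣ D)) := by
  induction n with
  | zero => exact ⟨1, one_pos, Or.inr ⟨rfl, rfl, Or.inl rfl⟩⟩
  | succ n ih =>
    have double := octagonSize_add_two n
    obtain ⟨D, hD, ⟨h, h'⟩ | ⟨h, h', -⟩⟩ := ih
    · exact ⟨2 * D, by omega, Or.inr ⟨by omega, by omega, Or.inr (dvd_mul_right 2 D)⟩⟩
    · exact ⟨D, hD, Or.inl ⟨by omega, by omega⟩⟩

theorem octagonSize_succ_sub_dvd (n : ℕ) :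
    octagonSize (n + 1) - octagonSize n ∣ octagonSize n := by
  obtain ⟨D, -, h⟩ := octagonSize_cases n
  rw [show octagonSize (n + 1) - octagonSize n = D by omega]
  rcases h with ⟨h, -⟩ | ⟨h, -⟩ <;> exact h ▸ dvd_mul_left _ _

/-- Lenstra's `n`-th octagon, rescaled to the lattice `J ℤ[i]`: a point `J z` with `z` a Gaussian
integer lies in `lenstraOctagon n J` when `z` lies in the octagon of sizes `octagonSize n / J` and
`octagonSize (n + 1) / J`. The octagon itself is the case `J = 1`. -/
def lenstraOctagon (n : ℕ) (J : ℤ) : Set GaussianInt :=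
  octagon (octagonSize n - 2 * J) (octagonSize (n + 1) - 3 * J)

theorem lenstraOctagon_zero : lenstraOctagon 0 1 = {0} := by
  ext z
  simp only [lenstraOctagon, mem_octagon_iff, octagonSize, Set.mem_singleton_iff, Zsqrtd.ext_iff,
    Zsqrtd.re_zero, Zsqrtd.im_zero]
  omega

theorem onePlusI_mul_onePlusI_mul_mem_lenstraOctagon_iff :
    onePlusI * (onePlusI * z) ∈ lenstraOctagon (n + 1 + 1) (2 * J) ↔ z ∈ lenstraOctagon n J := by
  have double := octagonSize_add_two n
  have double' := octagonSize_add_two (n + 1)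
  simp only [lenstraOctagon, mem_octagon_iff, re_onePlusI_mul, im_onePlusI_mul]
  omega

theorem lenstraOctagon_subset_succ (n : ℕ) : lenstraOctagon n 1 ⊆ lenstraOctagon (n + 1) 1 := by
  obtain ⟨D, hD, h⟩ := octagonSize_cases n
  have double := octagonSize_add_two n
  exact octagon_mono (by omega) (by omega)

theorem onePlusI_mul_mem_lenstraOctagon_succ (hz : z ∈ lenstraOctagon n 1) :
    onePlusI * z ∈ lenstraOctagon (n + 1) 1 := by
  have double := octagonSize_add_two n
  exact octagon_mono (by omega) (by omega) (onePlusI_mul_mem_octagon hz)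

theorem onePlusI_mul_add_one_mem_lenstraOctagon_succ (hz : z ∈ lenstraOctagon n 1) :
    onePlusI * z + 1 ∈ lenstraOctagon (n + 1) 1 := by
  have one_mem : (1 : GaussianInt) ∈ octagon 1 1 := by simp [octagon]
  have double := octagonSize_add_two n
  exact octagon_mono (by omega) (by omega) (add_mem_octagon (onePlusI_mul_mem_octagon hz) one_mem)

theorem mem_lenstraOctagon_of_onePlusI_mul_mem (hodd : ¬ onePlusI ∣ z)
    (hz : onePlusI * z ∈ lenstraOctagon (n + 1 + 1) 1) : z ∈ lenstraOctagon (n + 1) 1 := by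
  have double := octagonSize_add_two n
  have double' := octagonSize_add_two (n + 1)
  rw [onePlusI_dvd_iff] at hodd
  simp only [lenstraOctagon, mem_octagon_iff, re_onePlusI_mul, im_onePlusI_mul] at hz ⊢
  omega

theorem onePlusI_pow_mem_octagon (n : ℕ) :
    onePlusI ^ n ∈ octagon (octagonSize (n + 1) - octagonSize n)
      (octagonSize (n + 1 + 1) - octagonSize (n + 1)) := by
  induction n with
  | zero => simp [octagon, octagonSize]
  | succ n ih =>
    have double := octagonSize_add_two n
    have double' := octagonSize_add_two (n + 1)
    rw [pow_succ']
    exact octagon_mono le_rfl (by omega) (onePlusI_mul_mem_octagon ih)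

theorem onePlusI_pow_sub_mem_lenstraOctagon (hr : r ∈ lenstraOctagon n 1) :
    onePlusI ^ n - r ∈ lenstraOctagon (n + 1) 1 := by
  have neg_mem := unit_mul_mem_octagon (-1) hr
  rw [Units.val_neg, Units.val_one, neg_one_mul] at neg_mem
  rw [sub_eq_add_neg]
  exact octagon_mono (by omega) (by omega) (add_mem_octagon (onePlusI_pow_mem_octagon n) neg_mem)

theorem two_mul_sq_lt_three_mul_norm (hz : z ∉ lenstraOctagon n 1) :
    2 * (octagonSize n - 2) ^ 2 < 3 * z.norm := by
  obtain ⟨D, hD, hW⟩ := octagonSize_cases n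
  have norm_eq : z.norm = z.re ^ 2 + z.im ^ 2 := by rw [Zsqrtd.norm_def]; ring
  have norm_add_norm : (z.re + z.im) ^ 2 + (z.re - z.im) ^ 2 = 2 * z.norm := by rw [norm_eq]; ring
  have sq_le {m t : ℤ} (hm : 0 ≤ m) (h : m ≤ t ∨ m ≤ -t) : m ^ 2 ≤ t ^ 2 := by
    rw [sq_le_sq, abs_of_nonneg hm]
    exact le_abs.2 h
  have far : (octagonSize n - 1) ^ 2 ≤ z.norm ∨ (octagonSize (n + 1) - 2) ^ 2 ≤ 2 * z.norm := by
    rw [lenstraOctagon, mem_octagon_iff] at hz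
    rcases (by omega : (octagonSize n - 1 ≤ z.re ∨ octagonSize n - 1 ≤ -z.re) ∨
      (octagonSize n - 1 ≤ z.im ∨ octagonSize n - 1 ≤ -z.im) ∨
      (octagonSize (n + 1) - 2 ≤ z.re + z.im ∨ octagonSize (n + 1) - 2 ≤ -(z.re + z.im)) ∨
      (octagonSize (n + 1) - 2 ≤ z.re - z.im ∨ octagonSize (n + 1) - 2 ≤ -(z.re - z.im)))
      with h | h | h | h
    · left; linarith [sq_le (by omega) h, sq_nonneg z.im]
    · left; linarith [sq_le (by omega) h, sq_nonneg z.re]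
    · right; linarith [sq_le (by omega) h, sq_nonneg (z.re - z.im)]
    · right; linarith [sq_le (by omega) h, sq_nonneg (z.re + z.im)]
  rcases hW with ⟨hW, hW'⟩ | ⟨hW, hW', -⟩ <;> rw [hW, hW'] at far <;> rw [hW] <;>
    rcases far with far | far <;> nlinarith

theorem mem_lenstraOctagon_of_mul_mem (hd : ¬ onePlusI ∣ d) (h : b * d ∈ lenstraOctagon n 1) :
    b ∈ lenstraOctagon n 1 := by
  by_cases hunit : IsUnit d
  · obtain ⟨u, rfl⟩ := hunit
    rw [mul_comm] at h
    exact (unit_mul_mem_octagon_iff u).1 h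
  have three_le_norm : 3 ≤ d.norm := by
    have norm_nonneg := GaussianInt.norm_nonneg d
    have norm_ne_one := mt (Zsqrtd.norm_eq_one_iff' (by norm_num) d).1 hunit
    have norm_odd := mt two_dvd_norm_iff.1 hd
    omega
  by_contra hb
  have := calc
    3 * b.norm ≤ b.norm * d.norm := by nlinarith [GaussianInt.norm_nonneg b]
    _ = (b * d).norm := (Zsqrtd.norm_mul b d).symm
    _ ≤ 2 * (octagonSize n - 2) ^ 2 := norm_le_of_mem_octagon h
    _ < 3 * b.norm := two_mul_sq_lt_three_mul_norm hb
  exact this.false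

/-- The points `(1 + i) ^ s * y` with `s ≤ n` and `y` an odd point of the octagon of index `n - s`,
together with `0`. -/
def lenstraSet : ℕ → Set GaussianInt
  | 0 => {0}
  | n + 1 => {z | ¬ onePlusI ∣ z ∧ z ∈ lenstraOctagon (n + 1) 1} ∪ (onePlusI * ·) '' lenstraSet n

theorem zero_mem_lenstraSet (n : ℕ) : 0 ∈ lenstraSet n := by
  induction n with
  | zero => rfl
  | succ n ih => exact Or.inr ⟨0, ih, mul_zero _⟩

theorem lenstraSet_subset_lenstraOctagon (n : ℕ) : lenstraSet n ⊆ lenstraOctagon n 1 := by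
  induction n with
  | zero => exact lenstraOctagon_zero.superset
  | succ n ih =>
    rintro _ (h | ⟨y, hy, rfl⟩)
    · exact h.2
    · exact onePlusI_mul_mem_lenstraOctagon_succ (ih hy)

theorem mem_lenstraSet_iff_of_odd (hodd : ¬ onePlusI ∣ z) :
    z ∈ lenstraSet n ↔ z ∈ lenstraOctagon n 1 := by
  refine ⟨fun h => lenstraSet_subset_lenstraOctagon n h, fun h => ?_⟩
  cases n with
  | zero => exact lenstraOctagon_zero.subset h
  | succ n => exact Or.inl ⟨hodd, h⟩

theorem lenstraOctagon_one_subset_lenstraSet : lenstraOctagon 1 1 ⊆ lenstraSet 1 := by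
  intro z hz
  by_cases heven : onePlusI ∣ z
  · have z_eq_zero : z = 0 := by
      rw [onePlusI_dvd_iff] at heven
      simp only [lenstraOctagon, mem_octagon_iff, octagonSize] at hz
      simp only [Zsqrtd.ext_iff, Zsqrtd.re_zero, Zsqrtd.im_zero]
      omega
    exact z_eq_zero ▸ zero_mem_lenstraSet 1
  · exact Or.inl ⟨heven, hz⟩

theorem onePlusI_mul_mem_lenstraSet_succ_iff :
    onePlusI * z ∈ lenstraSet (n + 1) ↔ z ∈ lenstraSet n := by
  refine ⟨?_, fun h => Or.inr ⟨z, h, rfl⟩⟩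
  rintro (h | ⟨y, hy, h⟩)
  · exact absurd (dvd_mul_right onePlusI z) h.1
  · rwa [← mul_left_cancel₀ prime_onePlusI.ne_zero h]

theorem lenstraSet_subset_succ (n : ℕ) : lenstraSet n ⊆ lenstraSet (n + 1) := by
  induction n with
  | zero =>
    rintro _ rfl
    exact zero_mem_lenstraSet 1
  | succ n ih =>
    rintro _ (h | ⟨y, hy, rfl⟩)
    · exact Or.inl ⟨h.1, lenstraOctagon_subset_succ _ h.2⟩
    · exact Or.inr ⟨y, ih hy, rfl⟩

theorem mem_lenstraSet_of_mul_mem (hd : d ≠ 0) (h : b * d ∈ lenstraSet n) : b ∈ lenstraSet n := by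
  induction n generalizing b d with
  | zero => exact (mul_eq_zero.1 h).resolve_right hd
  | succ n ih =>
    by_cases hd_even : onePlusI ∣ d
    · obtain ⟨c, rfl⟩ := hd_even
      rw [mul_left_comm, onePlusI_mul_mem_lenstraSet_succ_iff] at h
      exact lenstraSet_subset_succ n (ih (right_ne_zero_of_mul hd) h)
    by_cases hb_even : onePlusI ∣ b
    · obtain ⟨c, rfl⟩ := hb_even
      rw [mul_assoc, onePlusI_mul_mem_lenstraSet_succ_iff] at h
      exact onePlusI_mul_mem_lenstraSet_succ_iff.2 (ih hd h)
    · have hbd_odd : ¬ onePlusI ∣ b * d := prime_onePlusI.not_dvd_mul hb_even hd_even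
      rw [mem_lenstraSet_iff_of_odd hbd_odd] at h
      exact (mem_lenstraSet_iff_of_odd hb_even).2 (mem_lenstraOctagon_of_mul_mem hd_even h)

theorem onePlusI_pow_notMem_lenstraSet (n : ℕ) : onePlusI ^ n ∉ lenstraSet n := by
  induction n with
  | zero => exact one_ne_zero
  | succ n ih => rwa [pow_succ', onePlusI_mul_mem_lenstraSet_succ_iff]

theorem onePlusI_pow_sub_mem_lenstraSet (hr : r ∈ lenstraSet n) :
    onePlusI ^ n - r ∈ lenstraSet (n + 1) := by
  induction n generalizing r with
  | zero =>
    rw [hr]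
    exact Or.inl ⟨by simpa using prime_onePlusI.not_dvd_one,
      by simp [lenstraOctagon, octagon, octagonSize]⟩
  | succ n ih =>
    have pow_even : onePlusI ∣ onePlusI ^ (n + 1) := dvd_pow_self _ n.succ_ne_zero
    by_cases heven : onePlusI ∣ r
    · obtain ⟨s, rfl⟩ := heven
      rw [pow_succ', ← mul_sub, onePlusI_mul_mem_lenstraSet_succ_iff]
      exact ih (onePlusI_mul_mem_lenstraSet_succ_iff.1 hr)
    · refine Or.inl ⟨(dvd_sub_right pow_even).not.2 heven, ?_⟩
      exact onePlusI_pow_sub_mem_lenstraOctagon (lenstraSet_subset_lenstraOctagon _ hr)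

theorem motzkinSet_succ_subset_lenstraSet_succ
    (h : motzkinSet GaussianInt n ⊆ lenstraSet n) :
    motzkinSet GaussianInt (n + 1) ⊆ lenstraSet (n + 1) := by
  rintro b (rfl | hb)
  · exact zero_mem_lenstraSet _
  obtain ⟨r, hr, q, hq⟩ := hb (onePlusI ^ n)
  refine mem_lenstraSet_of_mul_mem (d := q) ?_ (hq ▸ onePlusI_pow_sub_mem_lenstraSet (h hr))
  rintro rfl
  rw [mul_zero, sub_eq_zero] at hq
  exact onePlusI_pow_notMem_lenstraSet n (hq ▸ h hr)

end LenstraSet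

section Symmetry

variable {n : ℕ} {z : GaussianInt}

/-- The imaginary unit `i`, as a unit of the ring of Gaussian integers. -/
def unitI : GaussianIntˣ := ⟨⟨0, 1⟩, ⟨0, -1⟩, rfl, rfl⟩

theorem re_unitI_mul (z : GaussianInt) : (↑unitI * z).re = -z.im := by
  simp [unitI]

theorem im_unitI_mul (z : GaussianInt) : (↑unitI * z).im = z.re := by
  simp [unitI]

theorem exists_unit_abs_im_mul_le_re_mul (z : GaussianInt) :
    ∃ u : GaussianIntˣ, |(↑u * z).im| ≤ (↑u * z).re := by
  simp only [abs_le]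
  rcases (by omega : (-z.re ≤ z.im ∧ z.im ≤ z.re) ∨ (z.re ≤ z.im ∧ z.im ≤ -z.re) ∨
    (-z.im ≤ z.re ∧ z.re ≤ z.im) ∨ (z.im ≤ z.re ∧ z.re ≤ -z.im)) with h | h | h | h
  · exact ⟨1, by rwa [Units.val_one, one_mul]⟩
  · refine ⟨-1, ?_⟩
    rw [Units.val_neg, Units.val_one, neg_one_mul, Zsqrtd.re_neg, Zsqrtd.im_neg]
    omega
  · refine ⟨-unitI, ?_⟩
    rw [Units.val_neg, neg_mul, Zsqrtd.re_neg, Zsqrtd.im_neg, re_unitI_mul, im_unitI_mul]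
    omega
  · refine ⟨unitI, ?_⟩
    rw [re_unitI_mul, im_unitI_mul]
    omega

theorem symmetry_reduction {P : GaussianInt → GaussianInt → Prop}
    (unit_left : ∀ (u : GaussianIntˣ) b r, P (u * b) r → P b r)
    (unit_right : ∀ (u : GaussianIntˣ) b r, P b (u * r) → P b r)
    (conj : ∀ b r, P (star b) (star r) → P b r)
    (sector : ∀ b r, 0 ≤ b.im → b.im ≤ b.re → |r.im| ≤ r.re → P b r)
    (b r : GaussianInt) : P b r := by
  obtain ⟨u, hu⟩ := exists_unit_abs_im_mul_le_re_mul b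
  obtain ⟨v, hv⟩ := exists_unit_abs_im_mul_le_re_mul r
  refine unit_left u _ _ (unit_right v _ _ ?_)
  rcases le_total 0 (↑u * b).im with him | him
  · exact sector _ _ him ((le_abs_self _).trans hu) hv
  · refine conj _ _ (sector _ _ ?_ ?_ ?_)
    · rw [Zsqrtd.im_star]; exact neg_nonneg.2 him
    · rw [Zsqrtd.im_star, Zsqrtd.re_star]; exact (neg_le_abs _).trans hu
    · rwa [Zsqrtd.im_star, Zsqrtd.re_star, abs_neg]

theorem unit_mul_mem_lenstraSet (u : GaussianIntˣ) (hz : z ∈ lenstraSet n) :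
    ↑u * z ∈ lenstraSet n := by
  induction n generalizing z with
  | zero => rw [hz]; exact mul_zero _
  | succ n ih =>
    obtain ⟨hodd, hz⟩ | ⟨y, hy, rfl⟩ := hz
    · exact Or.inl ⟨mt u.isUnit.dvd_mul_left.1 hodd, unit_mul_mem_octagon u hz⟩
    · exact Or.inr ⟨u * y, ih hy, mul_left_comm _ _ _⟩

theorem star_mem_lenstraSet (hz : z ∈ lenstraSet n) : star z ∈ lenstraSet n := by
  induction n generalizing z with
  | zero => rw [hz]; exact star_zero _
  | succ n ih =>
    obtain ⟨hodd, hz⟩ | ⟨y, hy, rfl⟩ := hz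
    · exact Or.inl ⟨mt onePlusI_dvd_star_iff.1 hodd, star_mem_octagon hz⟩
    · have star_onePlusI_mul : onePlusI * (↑(-unitI) * star y) = star (onePlusI * y) := by
        rw [Units.val_neg, neg_mul, mul_neg]
        ext <;> simp only [Zsqrtd.re_neg, Zsqrtd.im_neg, Zsqrtd.re_star, Zsqrtd.im_star,
          re_onePlusI_mul, im_onePlusI_mul, re_unitI_mul, im_unitI_mul] <;> ring
      exact Or.inr ⟨_, unit_mul_mem_lenstraSet (-unitI) (ih hy), star_onePlusI_mul⟩

end Symmetry

section MinimalResidue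

variable {b r : GaussianInt}

/-- `r` has the smallest norm in its residue class modulo `b`. -/
def IsMinimalResidue (b r : GaussianInt) : Prop :=
  ∀ q, r.norm ≤ (r - q * b).norm

theorem exists_isMinimalResidue (a b : GaussianInt) : ∃ r, b ∣ a - r ∧ IsMinimalResidue b r := by
  let f : GaussianInt → ℕ := fun q => (a - q * b).norm.natAbs
  refine ⟨a - Function.argmin f * b, ⟨Function.argmin f, by ring⟩, fun q => ?_⟩
  have le_argmin : f (Function.argmin f) ≤ f (Function.argmin f + q) := Function.argmin_le f _
  have coe_f (q : GaussianInt) : (f q : ℤ) = (a - q * b).norm := GaussianInt.abs_natCast_norm _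
  rw [sub_sub, ← add_mul, ← coe_f, ← coe_f]
  exact_mod_cast le_argmin

theorem norm_unit_mul (u : GaussianIntˣ) (z : GaussianInt) : (↑u * z).norm = z.norm := by
  rw [Zsqrtd.norm_mul, (Zsqrtd.norm_eq_one_iff' (by norm_num) _).2 u.isUnit, one_mul]

namespace IsMinimalResidue

theorem unit_mul_left (h : IsMinimalResidue b r) (u : GaussianIntˣ) :
    IsMinimalResidue (u * b) r := fun q => by
  simpa only [mul_assoc] using h (q * u)

theorem unit_mul_right (h : IsMinimalResidue b r) (u : GaussianIntˣ) :
    IsMinimalResidue b (u * r) := fun q => calc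
  (↑u * r).norm = r.norm := norm_unit_mul u r
  _ ≤ (r - ↑u⁻¹ * q * b).norm := h _
  _ = (↑u * (r - ↑u⁻¹ * q * b)).norm := (norm_unit_mul u _).symm
  _ = (↑u * r - q * b).norm := by rw [mul_sub, mul_assoc, Units.mul_inv_cancel_left]

theorem star (h : IsMinimalResidue b r) : IsMinimalResidue (star b) (star r) := fun q => by
  have := h (Star.star q)
  rwa [← Zsqrtd.norm_conj r, ← Zsqrtd.norm_conj (r - _), star_sub, star_mul', star_star] at this

theorem two_mul_inner_lt_norm (h : IsMinimalResidue b r) (hb : ¬ onePlusI ∣ b) (u : GaussianIntˣ) :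
    2 * (r.re * (↑u * b).re + r.im * (↑u * b).im) < b.norm := by
  have norm_sub : (r - u * b).norm =
      r.norm + (↑u * b).norm - 2 * (r.re * (↑u * b).re + r.im * (↑u * b).im) := by
    simp only [Zsqrtd.norm_def, Zsqrtd.re_sub, Zsqrtd.im_sub]
    ring
  have norm_odd := mt two_dvd_norm_iff.1 hb
  have norm_le := h u
  rw [norm_sub, norm_unit_mul] at norm_le
  omega

theorem bounds_of_sector (h : IsMinimalResidue b r) (hb : ¬ onePlusI ∣ b) (him : 0 ≤ b.im)
    (hre : b.im ≤ b.re) :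
    2 * r.re < b.re + b.im ∧ r.re + r.im < b.re ∧ r.re - r.im < b.re := by
  have inner_b : 2 * (r.re * b.re + r.im * b.im) < b.norm := by
    simpa using h.two_mul_inner_lt_norm hb 1
  have inner_I_mul_b : 2 * (r.im * b.re - r.re * b.im) < b.norm := by
    have := h.two_mul_inner_lt_norm hb unitI
    rw [re_unitI_mul, im_unitI_mul] at this
    linarith
  have inner_neg_I_mul_b : 2 * (r.re * b.im - r.im * b.re) < b.norm := by
    have := h.two_mul_inner_lt_norm hb (-unitI)
    rw [Units.val_neg, neg_mul, Zsqrtd.re_neg, Zsqrtd.im_neg, re_unitI_mul, im_unitI_mul] at this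
    linarith
  have norm_eq : b.norm = b.re * b.re + b.im * b.im := by rw [Zsqrtd.norm_def]; ring
  have re_pos : 0 < b.re := by
    rw [onePlusI_dvd_iff] at hb
    omega
  have lt_of_mul_norm_lt {s t : ℤ} (hst : 2 * (s * b.norm) < 2 * (t * b.norm)) : s < t :=
    lt_of_mul_lt_mul_right (lt_of_mul_lt_mul_left hst zero_le_two) (GaussianInt.norm_nonneg b)
  -- Each left-hand side, times the norm of `b`, is a combination of the inner products above with
  -- nonnegative coefficients.
  have := sub_nonneg.2 hre
  refine ⟨lt_of_mul_norm_lt ?_, lt_of_mul_norm_lt ?_, lt_of_mul_norm_lt ?_⟩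
  · linear_combination 2 * b.re * inner_b + 2 * b.im * inner_neg_I_mul_b + 4 * r.re * norm_eq
  · linear_combination (b.re + b.im) * inner_b + (b.re - b.im) * inner_I_mul_b +
      2 * (r.re + r.im) * norm_eq
  · linear_combination (b.re - b.im) * inner_b + (b.re + b.im) * inner_neg_I_mul_b +
      2 * (r.re - r.im) * norm_eq

end IsMinimalResidue

end MinimalResidue

section Division

variable {n : ℕ} {b c r z : GaussianInt}

theorem exists_dvd_notMem_lenstraOctagon (hz : z ∉ lenstraSet n) :
    ∃ J : ℤ, 0 < J ∧ J ∣ octagonSize (n + 1) - octagonSize n ∧ (J : GaussianInt) ∣ z ∧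
      z ∉ lenstraOctagon n J := by
  have of_notMem {n : ℕ} {z : GaussianInt} (h : z ∉ lenstraOctagon n 1) :
      ∃ J : ℤ, 0 < J ∧ J ∣ octagonSize (n + 1) - octagonSize n ∧ (J : GaussianInt) ∣ z ∧
        z ∉ lenstraOctagon n J :=
    ⟨1, one_pos, one_dvd _, by rw [Int.cast_one]; exact one_dvd z, h⟩
  induction n using Nat.twoStepInduction generalizing z with
  | zero => exact of_notMem fun h => hz (lenstraOctagon_zero.subset h)
  | one => exact of_notMem fun h => hz (lenstraOctagon_one_subset_lenstraSet h)
  | more n ih _ =>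
    -- The factor `(1 + i) ^ 2 = 2 i` of an element doubles the scale.
    by_cases hz_dvd : onePlusI ∣ z
    swap
    · exact of_notMem (mt (mem_lenstraSet_iff_of_odd hz_dvd).2 hz)
    obtain ⟨y, rfl⟩ := hz_dvd
    rw [onePlusI_mul_mem_lenstraSet_succ_iff] at hz
    by_cases hy : onePlusI ∣ y
    swap
    · rw [mem_lenstraSet_iff_of_odd hy] at hz
      exact of_notMem (mt (mem_lenstraOctagon_of_onePlusI_mul_mem hy) hz)
    obtain ⟨x, rfl⟩ := hy
    rw [onePlusI_mul_mem_lenstraSet_succ_iff] at hz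
    obtain ⟨J, hJ, hJD, hJx, hx⟩ := ih hz
    refine ⟨2 * J, by omega, ?_, ?_,
      mt onePlusI_mul_onePlusI_mul_mem_lenstraOctagon_iff.1 hx⟩
    · rw [octagonSize_add_two, octagonSize_add_two, ← mul_sub]
      exact mul_dvd_mul_left 2 hJD
    · rw [Int.cast_mul, ← mul_assoc]
      exact mul_dvd_mul ⟨unitI, by decide⟩ hJx

theorem le_of_dvd_of_lt_add {J s t : ℤ} (hs : J ∣ s) (ht : J ∣ t) (h : s < t + J) : s ≤ t := by
  by_contra hst
  have := Int.le_of_dvd (by omega) (hs.sub ht)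
  omega

theorem IsMinimalResidue.mem_lenstraOctagon_of_sector (h : IsMinimalResidue b r)
    (hb_odd : ¬ onePlusI ∣ b) (hb : b ∈ lenstraOctagon (n + 1) 1) (him : 0 ≤ b.im)
    (hre : b.im ≤ b.re) (hr : |r.im| ≤ r.re) : r ∈ lenstraOctagon n 1 := by
  obtain ⟨h₁, h₂, h₃⟩ := h.bounds_of_sector hb_odd him hre
  have double := octagonSize_add_two n
  simp only [lenstraOctagon, mem_octagon_iff] at hb ⊢
  rw [abs_le] at hr
  omega

theorem exists_scale_of_notMem_lenstraSet (hr_notMem : r ∉ lenstraSet n) (hr : |r.im| ≤ r.re) :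
    ∃ J, 0 < J ∧
      (J = octagonSize (n + 1) - octagonSize n ∨ 2 * J ≤ octagonSize (n + 1) - octagonSize n) ∧
      J ≤ r.re ∧
      (octagonSize n - octagonSize (n + 1) < r.im →
        J - (octagonSize (n + 1) - octagonSize n) ≤ r.im) ∧
      (octagonSize n - J ≤ r.re ∨ octagonSize (n + 1) - 2 * J ≤ r.re + r.im ∨
        octagonSize (n + 1) - 2 * J ≤ r.re - r.im) := by
  obtain ⟨J, hJ, hJD, hJr, hr_notMem⟩ := exists_dvd_notMem_lenstraOctagon hr_notMem
  obtain ⟨hJre, hJim⟩ := Zsqrtd.intCast_dvd _ _ |>.1 hJr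
  have dvd_size : J ∣ octagonSize n := hJD.trans (octagonSize_succ_sub_dvd n)
  have dvd_size_succ : J ∣ octagonSize (n + 1) := (dvd_sub_left dvd_size).1 hJD
  obtain ⟨D, hD, hW⟩ := octagonSize_cases n
  rw [abs_le] at hr
  rw [lenstraOctagon, mem_octagon_iff] at hr_notMem
  -- The sizes and both coordinates of `r` are multiples of `J`, so each inequality between them
  -- holds as soon as it holds up to an error less than `J`.
  have le_size_diff := le_of_dvd_of_lt_add dvd_rfl hJD
  have eq_or_two_mul_le := le_of_dvd_of_lt_add (dvd_mul_left J 2) hJD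
  have le_re := le_of_dvd_of_lt_add dvd_rfl hJre
  have le_im := le_of_dvd_of_lt_add (dvd_rfl.sub hJD) hJim
  have far_re := le_of_dvd_of_lt_add (dvd_size.sub dvd_rfl) hJre
  have far_add := le_of_dvd_of_lt_add (dvd_size_succ.sub (dvd_mul_left J 2)) (hJre.add hJim)
  have far_sub := le_of_dvd_of_lt_add (dvd_size_succ.sub (dvd_mul_left J 2)) (hJre.sub hJim)
  refine ⟨J, hJ, ?_, ?_, ?_, ?_⟩ <;> omega

theorem exists_unit_sub_mul_mem_lenstraOctagon_of_sector (h : IsMinimalResidue b r)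
    (hb_odd : ¬ onePlusI ∣ b) (hb : b ∈ lenstraOctagon (n + 1) 1) (him : 0 ≤ b.im)
    (hre : b.im ≤ b.re) (hr : |r.im| ≤ r.re) (hr_even : onePlusI ∣ r)
    (hr_notMem : r ∉ lenstraSet n) :
    ∃ u : GaussianIntˣ, r - u * b ∈ lenstraOctagon n 1 := by
  obtain ⟨D, hD, hW⟩ := octagonSize_cases n
  obtain ⟨J, hJ, hJD, J_le_re, J_le_im, hfar⟩ := exists_scale_of_notMem_lenstraSet hr_notMem hr
  obtain ⟨h₁, h₂, h₃⟩ := h.bounds_of_sector hb_odd him hre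
  have r_mem := h.mem_lenstraOctagon_of_sector hb_odd hb him hre hr
  rw [abs_le] at hr
  rw [onePlusI_dvd_iff] at hb_odd hr_even
  suffices r - b ∈ lenstraOctagon n 1 ∨ r - ↑(-unitI) * b ∈ lenstraOctagon n 1 by
    rcases this with this | this
    · exact ⟨1, by rwa [Units.val_one, one_mul]⟩
    · exact ⟨_, this⟩
  simp only [lenstraOctagon, mem_octagon_iff, Units.val_neg, neg_mul, sub_neg_eq_add, Zsqrtd.re_sub,
    Zsqrtd.im_sub, Zsqrtd.re_add, Zsqrtd.im_add, re_unitI_mul, im_unitI_mul] at hb r_mem ⊢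
  have double := octagonSize_add_two n
  clear h hr_notMem
  by_cases him_nonneg : 0 ≤ r.im
  · left
    rcases hW with hW | ⟨hW, hW', hD⟩ <;> rcases hJD with hJD | hJD <;>
      rcases hfar with hfar | hfar | hfar <;> omega
  · rcases hW with hW | ⟨hW, hW', hD⟩ <;> rcases hJD with hJD | hJD <;>
      rcases hfar with hfar | hfar | hfar <;> omega

theorem exists_mem_lenstraSet_dvd_sub_of_isMinimalResidue (hb_odd : ¬ onePlusI ∣ b)
    (hb : b ∈ lenstraOctagon (n + 1) 1) (hr : IsMinimalResidue b r) :
    ∃ s ∈ lenstraSet n, b ∣ r - s := by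
  induction b, r using symmetry_reduction with
  | unit_left u b r ih =>
    obtain ⟨s, hs, hdvd⟩ := ih (mt u.isUnit.dvd_mul_left.1 hb_odd) (unit_mul_mem_octagon u hb)
      (hr.unit_mul_left u)
    exact ⟨s, hs, u.isUnit.mul_left_dvd.1 hdvd⟩
  | unit_right u b r ih =>
    obtain ⟨s, hs, hdvd⟩ := ih hb_odd hb (hr.unit_mul_right u)
    refine ⟨↑u⁻¹ * s, unit_mul_mem_lenstraSet _ hs, ?_⟩
    rw [← u.isUnit.dvd_mul_left, mul_sub, Units.mul_inv_cancel_left]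
    exact hdvd
  | conj b r ih =>
    obtain ⟨s, hs, hdvd⟩ := ih (mt onePlusI_dvd_star_iff.1 hb_odd) (star_mem_octagon hb) hr.star
    exact ⟨star s, star_mem_lenstraSet hs, by
      simpa [starRingEnd_apply] using map_dvd (starRingEnd GaussianInt) hdvd⟩
  | sector b r him hre hr_sector =>
    by_cases hr_mem : r ∈ lenstraSet n
    · exact ⟨r, hr_mem, by rw [sub_self]; exact dvd_zero b⟩
    have hr_even : onePlusI ∣ r := by
      by_contra hr_odd
      exact hr_mem ((mem_lenstraSet_iff_of_odd hr_odd).2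
        (hr.mem_lenstraOctagon_of_sector hb_odd hb him hre hr_sector))
    obtain ⟨u, hu⟩ := exists_unit_sub_mul_mem_lenstraOctagon_of_sector hr hb_odd hb him hre
      hr_sector hr_even hr_mem
    have sub_odd : ¬ onePlusI ∣ r - u * b := by
      rwa [dvd_sub_right hr_even, u.isUnit.dvd_mul_left]
    exact ⟨r - u * b, (mem_lenstraSet_iff_of_odd sub_odd).2 hu, u, by ring⟩

theorem exists_mem_lenstraSet_dvd_sub_of_odd (hb_odd : ¬ onePlusI ∣ b)
    (hb : b ∈ lenstraOctagon (n + 1) 1) (a : GaussianInt) : ∃ r ∈ lenstraSet n, b ∣ a - r := by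
  obtain ⟨r, har, hr⟩ := exists_isMinimalResidue a b
  obtain ⟨s, hs, hrs⟩ := exists_mem_lenstraSet_dvd_sub_of_isMinimalResidue hb_odd hb hr
  exact ⟨s, hs, sub_add_sub_cancel a r s ▸ har.add hrs⟩

theorem exists_mem_lenstraSet_succ_onePlusI_mul_dvd_sub
    (h : ∀ a, ∃ r ∈ lenstraSet n, c ∣ a - r) (a : GaussianInt) :
    ∃ r ∈ lenstraSet (n + 1), onePlusI * c ∣ a - r := by
  by_cases ha : onePlusI ∣ a
  · obtain ⟨a', rfl⟩ := ha
    obtain ⟨r, hr, hdvd⟩ := h a'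
    exact ⟨onePlusI * r, Or.inr ⟨r, hr, rfl⟩, mul_sub onePlusI a' r ▸ mul_dvd_mul_left _ hdvd⟩
  · obtain ⟨a', ha'⟩ := onePlusI_dvd_sub_one ha
    obtain ⟨r, hr, hdvd⟩ := h a'
    have odd : ¬ onePlusI ∣ onePlusI * r + 1 :=
      (dvd_add_right (dvd_mul_right _ r)).not.2 prime_onePlusI.not_dvd_one
    refine ⟨onePlusI * r + 1, Or.inl ⟨odd, onePlusI_mul_add_one_mem_lenstraOctagon_succ
      (lenstraSet_subset_lenstraOctagon n hr)⟩, ?_⟩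
    rw [sub_add_eq_sub_sub_swap, ha', ← mul_sub]
    exact mul_dvd_mul_left _ hdvd

theorem exists_mem_lenstraSet_dvd_sub (hb : b ≠ 0) (hb_mem : b ∈ lenstraSet (n + 1))
    (a : GaussianInt) : ∃ r ∈ lenstraSet n, b ∣ a - r := by
  induction n generalizing a b with
  | zero =>
    obtain ⟨hb_odd, hb_oct⟩ | ⟨c, rfl, rfl⟩ := hb_mem
    · exact exists_mem_lenstraSet_dvd_sub_of_odd hb_odd hb_oct a
    · exact absurd (mul_zero _) hb
  | succ n ih =>
    obtain ⟨hb_odd, hb_oct⟩ | ⟨c, hc, rfl⟩ := hb_mem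
    · exact exists_mem_lenstraSet_dvd_sub_of_odd hb_odd hb_oct a
    · exact exists_mem_lenstraSet_succ_onePlusI_mul_dvd_sub (ih (right_ne_zero_of_mul hb) hc) a

theorem motzkinSet_eq_lenstraSet (n : ℕ) : motzkinSet GaussianInt n = lenstraSet n := by
  induction n with
  | zero => rfl
  | succ n ih =>
    refine (motzkinSet_succ_subset_lenstraSet_succ ih.subset).antisymm fun b hb => ?_
    refine or_iff_not_imp_left.2 fun hb0 a => ?_
    rw [ih]
    exact exists_mem_lenstraSet_dvd_sub hb0 hb a

end Division

section Counting

variable {A a : ℕ}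

/-- The odd Gaussian integers `x + y i` with `|x| + |y| ≤ B`, for odd `B`, in the coordinates
`s = (B + x + y) / 2` and `t = (B + x - y) / 2` ranging over `0, …, B`. -/
def oddDiamondPoint (B : ℕ) (p : (_ : ℕ) × ℕ) : GaussianInt :=
  ⟨p.1 + p.2 - B, p.1 - p.2⟩

theorem oddDiamondPoint_injective (B : ℕ) : Function.Injective (oddDiamondPoint B) := by
  rintro ⟨s, t⟩ ⟨s', t'⟩ h
  obtain ⟨hre, him⟩ := Zsqrtd.ext_iff.1 h
  dsimp only [oddDiamondPoint] at hre him
  obtain ⟨rfl, rfl⟩ : s = s' ∧ t = t' := by omega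
  rfl

/-- Where the `s`-th column of an octagon starts in the coordinates of `oddDiamondPoint`; by
symmetry it ends as far from the other end. -/
def columnStart (A a s : ℕ) : ℕ := (a - s) + (s - A)

theorem sum_columnStart (A a : ℕ) :
    ∑ s ∈ Finset.range (A + a + 1), columnStart A a s = a * (a + 1) := by
  have sum_left : ∑ s ∈ Finset.range (A + a + 1), (a - s) = ∑ s ∈ Finset.range (a + 1), s := by
    rw [show A + a + 1 = a + 1 + A by omega, Finset.sum_range_add,
      Finset.sum_eq_zero fun s _ => (by omega : a - (a + 1 + s) = 0), add_zero]
    exact Finset.sum_flip fun s => s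
  have sum_right : ∑ s ∈ Finset.range (A + a + 1), (s - A) =
      ∑ s ∈ Finset.range (A + a + 1), (a - s) := by
    rw [← Finset.sum_flip]
    exact Finset.sum_congr rfl fun s hs => by rw [Finset.mem_range] at hs; omega
  simp only [columnStart]
  rw [Finset.sum_add_distrib, sum_right, sum_left, ← mul_two, Finset.sum_range_id_mul_two,
    Nat.add_sub_cancel, mul_comm]

theorem odd_octagon_eq_image (ha : a ≤ A + 1) (hodd : Odd (A + a)) :
    {z | ¬ onePlusI ∣ z ∧ z ∈ octagon A (A + a : ℕ)} = oddDiamondPoint (A + a) ''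
      (Finset.range (A + a + 1)).sigma
        fun s => Finset.Icc (columnStart A a s) (A + a - columnStart A a s) := by
  obtain ⟨m, hm⟩ := hodd
  ext z
  simp only [Set.mem_ofPred_eq, onePlusI_dvd_iff, mem_octagon_iff, Set.mem_image, SetLike.mem_coe,
    Finset.mem_sigma, Finset.mem_range, Finset.mem_Icc, columnStart]
  constructor
  · rintro ⟨hz_odd, hz⟩
    refine ⟨⟨((A + a + z.re + z.im) / 2).toNat, ((A + a + z.re - z.im) / 2).toNat⟩, ?_,
      Zsqrtd.ext ?_ ?_⟩ <;> dsimp only [oddDiamondPoint] <;> omega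
  · rintro ⟨⟨s, t⟩, h, rfl⟩
    dsimp only [oddDiamondPoint] at h ⊢
    omega

theorem ncard_odd_octagon (ha : a ≤ A + 1) (hodd : Odd (A + a)) :
    {z | ¬ onePlusI ∣ z ∧ z ∈ octagon A (A + a : ℕ)}.ncard + 2 * (a * (a + 1)) =
      (A + a + 1) ^ 2 := by
  rw [odd_octagon_eq_image ha hodd, Set.ncard_image_of_injective _ (oddDiamondPoint_injective _),
    Set.ncard_coe_finset, Finset.card_sigma, ← sum_columnStart A a, Finset.mul_sum,
    ← Finset.sum_add_distrib]
  calc _ = ∑ s ∈ Finset.range (A + a + 1), (A + a + 1) := by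
        refine Finset.sum_congr rfl fun s hs => ?_
        rw [Finset.mem_range] at hs
        rw [Nat.card_Icc, columnStart]
        omega
    _ = (A + a + 1) ^ 2 := by rw [Finset.sum_const, Finset.card_range, smul_eq_mul, sq]

theorem lenstraSet_finite (n : ℕ) : (lenstraSet n).Finite :=
  (octagon_finite _ _).subset (lenstraSet_subset_lenstraOctagon n)

theorem ncard_odd_lenstraOctagon_succ (n : ℕ) :
    ({z | ¬ onePlusI ∣ z ∧ z ∈ lenstraOctagon (n + 1) 1}.ncard : ℤ) =
      (octagonSize (n + 1 + 1) - 2) ^ 2 -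
        2 * (octagonSize (n + 1 + 1) - octagonSize (n + 1) - 1) *
          (octagonSize (n + 1 + 1) - octagonSize (n + 1)) := by
  obtain ⟨D, hD, hW⟩ := octagonSize_cases (n + 1)
  have double := octagonSize_add_two n
  obtain ⟨A, hA⟩ := Int.eq_ofNat_of_zero_le (show 0 ≤ octagonSize (n + 1) - 2 by omega)
  obtain ⟨a, ha⟩ := Int.eq_ofNat_of_zero_le
    (show 0 ≤ octagonSize (n + 1 + 1) - octagonSize (n + 1) - 1 by omega)
  have card := ncard_odd_octagon (A := A) (a := a) (by omega) (Nat.odd_iff.2 (by omega))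
  have octagon_eq : octagon A (A + a : ℕ) = lenstraOctagon (n + 1) 1 := by
    rw [lenstraOctagon]
    congr 1 <;> omega
  rw [octagon_eq] at card
  rw [ha, show octagonSize (n + 1 + 1) - 2 = A + a + 1 by omega,
    show octagonSize (n + 1 + 1) - octagonSize (n + 1) = a + 1 by omega]
  zify at card
  linear_combination card

theorem ncard_lenstraSet_succ (n : ℕ) :
    ((lenstraSet (n + 1)).ncard : ℤ) = (lenstraSet n).ncard + (octagonSize (n + 1 + 1) - 2) ^ 2 -
      2 * (octagonSize (n + 1 + 1) - octagonSize (n + 1) - 1) *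
        (octagonSize (n + 1 + 1) - octagonSize (n + 1)) := by
  have disjoint : Disjoint {z | ¬ onePlusI ∣ z ∧ z ∈ lenstraOctagon (n + 1) 1}
      ((onePlusI * ·) '' lenstraSet n) := by
    rw [Set.disjoint_left]
    rintro _ ⟨hodd, -⟩ ⟨y, -, rfl⟩
    exact hodd (dvd_mul_right _ y)
  have odd_finite : {z | ¬ onePlusI ∣ z ∧ z ∈ lenstraOctagon (n + 1) 1}.Finite :=
    (octagon_finite _ _).subset fun _ hz => hz.2
  rw [lenstraSet, Set.ncard_union_eq disjoint odd_finite ((lenstraSet_finite n).image _),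
    Set.ncard_image_of_injective _ (mul_right_injective₀ prime_onePlusI.ne_zero), Nat.cast_add,
    ncard_odd_lenstraOctagon_succ]
  ring

theorem octagonSize_two_mul (k : ℕ) :
    octagonSize (2 * k) = 2 * 2 ^ k ∧ octagonSize (2 * k + 1) = 3 * 2 ^ k := by
  induction k with
  | zero => exact ⟨rfl, rfl⟩
  | succ k ih =>
    rw [Nat.mul_succ, octagonSize_add_two, octagonSize_add_two, ih.1, ih.2, pow_succ']
    exact ⟨rfl, mul_left_comm _ _ _⟩

theorem ncard_lenstraSet_two_mul (k : ℕ) :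
    ((lenstraSet (2 * k)).ncard : ℤ) = 21 + 8 * k - 34 * 2 ^ k + 14 * 4 ^ k := by
  induction k with
  | zero => simp [lenstraSet]
  | succ k ih =>
    obtain ⟨size_even, size_odd⟩ := octagonSize_two_mul k
    have four_pow : (4 : ℤ) ^ k = 2 ^ k * 2 ^ k := by rw [← mul_pow]; norm_num
    rw [Nat.mul_succ, ncard_lenstraSet_succ, ncard_lenstraSet_succ, ih]
    simp only [octagonSize_add_two, size_even, size_odd]
    push_cast
    rw [pow_succ (2 : ℤ) k, pow_succ (4 : ℤ) k, four_pow]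
    ring

end Counting

theorem mainTheorem2 (k : ℕ) (hk : 1 ≤ k) :
    ((minimalEuclideanFunction GaussianInt ⁻¹' Set.Icc 0 (2 * k + 1)).ncard : ℤ) =
      29 + 8 * (k : ℤ) - 68 * 2 ^ k + 56 * 4 ^ k := by
  have preimage_eq : minimalEuclideanFunction GaussianInt ⁻¹' Set.Icc 0 (2 * k + 1) =
      lenstraSet (2 * (k + 1)) := by
    ext z
    rw [Set.mem_preimage, Set.mem_Icc, and_iff_right (Nat.zero_le _),
      minimalEuclideanFunction_le_iff_mem_motzkinSet isEuclideanFunction_natAbs_norm,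
      motzkinSet_eq_lenstraSet]
    rfl
  rw [preimage_eq, ncard_lenstraSet_two_mul]
  push_cast
  ring
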